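/- **Setting.** Fix a vocabulary of predicates (with arities) and constants, and an infinite set of variables. A *term* is a variable or a constant. A *fact* or *query* (Boolean conjunctive query) is a finite set of atoms, read as the existentially closed conjunction of its elements. A *rule* $R$ is a formula $\forall \vec x\,\forall \vec y\,(B[\vec x,\vec y]\to\exists \vec z\,H[\vec y,\vec z])$ with $B=\mathrm{body}(R)$ and $H=\mathrm{head}(R)$ finite conjunctions of atoms; its *existential variables* are those in $\mathrm{vars}(H)\setminus\mathrm{vars}(B)$. $\models$ is classical logical consequence. $A\ge B$ ("$A$ is more general than $B$") means that there is a homomorphism from $A$ to $B$, i.e. a substitution $h$ of variables by terms with $h(A)\subseteq B$. A *rewriting operator* $\mathrm{rew}$ maps a query $Q$ and a set of rules $\mathcal R$ to a set of queries. The only $0$-rewriting of $Q$ is $Q$; a $(k+1)$-rewriting of $Q$ is an element of $\mathrm{rew}(Q',\mathcal R)$ for some $k$-rewriting $Q'$ of $Q$; $W_\infty(Q,\mathcal R)$ is the set of all $k$-rewritings of $Q$, $k\ge 0$. The operator is * *sound* if for all $\mathcal R$, $Q$, $Q'\in\mathrm{rew}(Q,\mathcal R)$ and every fact $F$: $F\models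 Q'$ implies $F,\mathcal R\models Q$; * *complete* if for all $\mathcal R$, $Q$ and every fact $F$ with $F,\mathcal R\models Q$ there is $Q'\in W_\infty(Q,\mathcal R)$ with $F\models Q'$; * *prunable* if for all $\mathcal R$, $Q_1$, $Q_2$, $Q_2'$ with $Q_1\ge Q_2$, $Q_2'\in\mathrm{rew}(Q_2,\mathcal R)$ and $Q_1\not\ge Q_2'$ there is $Q_1'\in\mathrm{rew}(Q_1,\mathcal R)$ with $Q_1'\ge Q_2'$. Let $Q$ and $R$ have disjoint sets of variables. A *piece-unifier* of $Q$ with $R$ is a triple $\mu=(Q',H',P)$ where $\emptyset\ne Q'\subseteq Q$, $H'\subseteq \mathrm{head}(R)$ and $P$ is a partition of $\mathrm{terms}(Q')\cup\mathrm{terms}(H')$ such that (1) no class contains two constants; (2) if a class contains an existential variable of $R$, then the other terms of the class are variables of $Q'$ that do not occur in $Q\setminus Q'$; (3) $u(H')=u(Q')$, where $u$ is a substitution associated with $P$, i.e. one that sends every term of a class to one selected element of the class, with priority given to constants, and does not affect other variables. It is *most general* if no piece-unifier $(Q',H',P_1)$ of $Q$ with $R$ on the same $Q'$ and $H'$ has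 a partition $P_1$ strictly finer than $P$. The *one-step piece-rewriting* of $Q$ according to $\mu$ is $\beta(Q,R,\mu)=u(\mathrm{body}(R))\cup u(Q\setminus Q')$, for an associated substitution $u$. The *piece-based rewriting operator* maps $(Q,\mathcal R)$ to the set of all $\beta(Q,R,\mu)$, where $R$ is a copy of a rule of $\mathcal R$ whose variables are renamed apart from those of $Q$ and $\mu$ is a piece-unifier of $Q$ with $R$. A *piece-rewriting* of $Q$ is a $k$-rewriting of $Q$ for this operator, for some $k\ge 0$. **Theorem.** 1. The piece-based rewriting operator is sound, complete and prunable. 2. The operator obtained from it by using only most general piece-unifiers is also sound, complete and prunable. 3. Let $R$ be a rule that shares no variable with the queries $Q_1$ and $Q_2$. If $Q_1\ge Q_2$, then for any piece-unifier $\mu_2$ of $Q_2$ with $R$, either $Q_1\ge\beta(Q_2,R,\mu_2)$, or there is a piece-unifier $\mu_1$ of $Q_1$ with $R$ such that $\beta(Q_1,R,\mu_1)\ge\beta(Q_2,R,\mu_2)$ (whatever the associated substitutions). 4. For every fact $F$, every set of rules $\mathcal R$ and every query $Q$: $F,\mathcal R\models Q$ if and only if there is a piece-rewriting $Q'$ of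 $Q$ with $Q'\ge F$. -/

import Mathlib

universe u v w

namespace ExistentialRules



/-- A term is a variable or a constant. The vocabulary is given by a first-order language `L`, of
which only the relation symbols and the constants are used. -/
inductive Term (L : FirstOrder.Language.{u, v}) (V : Type w) : Type (max u w)
  | var (x : V) : Term L V
  | const (c : L.Constants) : Term L V

/-- An atom `p(t₁, …, tₖ)`. -/
structure Atom (L : FirstOrder.Language.{u, v}) (V : Type w) : Type (max u v w) where
  arity : ℕ
  pred : L.Relations arity
  args : Fin arity → Term L V

/-- A finite set of atoms, seen as the existentially closed conjunction of its elements: this is a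
fact, or equivalently a Boolean conjunctive query. -/
abbrev Query (L : FirstOrder.Language.{u, v}) (V : Type w) : Type (max u v w) := Finset (Atom L V)

/-- A substitution; it is the identity on the variables that it does not affect. -/
abbrev Subst (L : FirstOrder.Language.{u, v}) (V : Type w) : Type (max u w) := V → Term L V

section Basic

variable {L : FirstOrder.Language.{u, v}} {V : Type w}

/-- Application of a substitution to a term (constants are fixed). -/
def Term.subst (s : Subst L V) : Term L V → Term L V
  | .var x => s x
  | .const c => .const c

/-- Application of a substitution to an atom. -/
def Atom.subst (s : Subst L V) (a : Atom L V) : Atom L V :=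
  ⟨a.arity, a.pred, fun i => (a.args i).subst s⟩

open scoped Classical in
/-- Application of a substitution to a set of atoms. -/
noncomputable def Query.subst (s : Subst L V) (A : Query L V) : Query L V :=
  A.image (Atom.subst s)

/-- The terms occurring in a set of atoms. -/
def Query.terms (A : Query L V) : Set (Term L V) :=
  {t | ∃ a ∈ A, ∃ i, a.args i = t}

/-- The variables occurring in a set of atoms. -/
def Query.vars (A : Query L V) : Set V :=
  {x | Term.var x ∈ Query.terms A}

/-- `A` is more general than `B` (`A ≥ B`): there is a homomorphism from `A` to `B`. -/
def MoreGeneral (A B : Query L V) : Prop :=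
  ∃ h : Subst L V, Query.subst h A ⊆ B

end Basic

/-- The existential rule `∀ x y, (B[x, y] → ∃ z, H[y, z])` with body `B` and head `H`. -/
structure Rule (L : FirstOrder.Language.{u, v}) (V : Type w) : Type (max u v w) where
  body : Query L V
  head : Query L V

section Rules

variable {L : FirstOrder.Language.{u, v}} {V : Type w}

/-- All the variables of a rule. -/
def Rule.vars (R : Rule L V) : Set V := Query.vars R.body ∪ Query.vars R.head

/-- The existential variables of a rule: those of the head that are not in the frontier. -/
def Rule.exVars (R : Rule L V) : Set V := Query.vars R.head \ Query.vars R.body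

/-- `R'` is a copy of `R` obtained by a bijective renaming of its variables. -/
def Rule.IsCopy (R R' : Rule L V) : Prop :=
  ∃ r : V → V, Set.InjOn r R.vars ∧
    R'.body = Query.subst (fun x => Term.var (r x)) R.body ∧
    R'.head = Query.subst (fun x => Term.var (r x)) R.head

end Rules

section Semantics

variable {L : FirstOrder.Language.{u, v}} {V : Type w}

/-- Value of a term in an `L`-structure under an assignment of the variables. -/
def Term.val {M : Type*} [L.Structure M] (e : V → M) : Term L V → M
  | .var x => e x
  | .const c => (c : M)

/-- The conjunction of the atoms of `A` is true in `M` under the assignment `e`. -/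
def Query.Holds {M : Type*} [L.Structure M] (e : V → M) (A : Query L V) : Prop :=
  ∀ a ∈ A, FirstOrder.Language.Structure.RelMap a.pred (fun i => (a.args i).val e)

/-- `M` is a model of the existential closure of the conjunction of `A`. -/
def Query.Sat (M : Type*) [L.Structure M] (A : Query L V) : Prop :=
  ∃ e : V → M, Query.Holds e A

/-- `M` is a model of the rule `R`: an assignment satisfying the body can be modified outside the
variables of the body into an assignment satisfying the head. -/
def Rule.Sat (M : Type*) [L.Structure M] (R : Rule L V) : Prop :=
  ∀ e : V → M, Query.Holds e R.body →
    ∃ e' : V → M, (∀ x ∈ Query.vars R.body, e' x = e x) ∧ Query.Holds e' R.head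

/-- Classical logical consequence `F, 𝓡 ⊨ Q`. -/
def Entails (F : Query L V) (𝓡 : Set (Rule L V)) (Q : Query L V) : Prop :=
  ∀ (M : Type (max u v w)) [L.Structure M] [Nonempty M],
    Query.Sat M F → (∀ R ∈ 𝓡, Rule.Sat M R) → Query.Sat M Q

end Semantics

/-- A rewriting operator maps a query and a set of rules to a set of queries. -/
abbrev RewOp (L : FirstOrder.Language.{u, v}) (V : Type w) : Type (max u v w) :=
  Query L V → Set (Rule L V) → Set (Query L V)

namespace RewOp

variable {L : FirstOrder.Language.{u, v}} {V : Type w}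

/-- The set of `k`-rewritings of `Q`; the only `0`-rewriting is `Q` itself. -/
def iter (rew : RewOp L V) (Q : Query L V) (𝓡 : Set (Rule L V)) : ℕ → Set (Query L V)
  | 0 => {Q}
  | k + 1 => {Q'' | ∃ Q' ∈ iter rew Q 𝓡 k, Q'' ∈ rew Q' 𝓡}

/-- The `k`-saturation: all the `i`-rewritings of `Q` for `i ≤ k`. -/
def sat (rew : RewOp L V) (Q : Query L V) (𝓡 : Set (Rule L V)) (k : ℕ) : Set (Query L V) :=
  {Q' | ∃ i ≤ k, Q' ∈ rew.iter Q 𝓡 i}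

/-- The union of all the `k`-saturations. -/
def satInf (rew : RewOp L V) (Q : Query L V) (𝓡 : Set (Rule L V)) : Set (Query L V) :=
  ⋃ k : ℕ, rew.sat Q 𝓡 k

/-- Soundness of a rewriting operator. -/
def Sound (rew : RewOp L V) : Prop :=
  ∀ (𝓡 : Set (Rule L V)) (Q : Query L V), ∀ Q' ∈ rew Q 𝓡, ∀ F : Query L V,
    Entails F ∅ Q' → Entails F 𝓡 Q

/-- Completeness of a rewriting operator. -/
def Complete (rew : RewOp L V) : Prop :=
  ∀ (𝓡 : Set (Rule L V)) (Q : Query L V) (F : Query L V),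
    Entails F 𝓡 Q → ∃ Q' ∈ rew.satInf Q 𝓡, Entails F ∅ Q'

/-- Prunability of a rewriting operator. -/
def Prunable (rew : RewOp L V) : Prop :=
  ∀ (𝓡 : Set (Rule L V)) (Q₁ Q₂ Q₂' : Query L V),
    MoreGeneral Q₁ Q₂ → Q₂' ∈ rew Q₂ 𝓡 → ¬ MoreGeneral Q₁ Q₂' →
      ∃ Q₁' ∈ rew Q₁ 𝓡, MoreGeneral Q₁' Q₂'

end RewOp

section PieceUnifiers

variable {L : FirstOrder.Language.{u, v}} {V : Type w}

/-- Partitions of a set `T` of terms, given by the equivalence relation "being in the same class".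
For this type `P₁ ≤ P₂` means that every class of `P₁` is included in a class of `P₂`, i.e. that
`P₁` is finer than `P₂`. -/
abbrev TermPartition (T : Set (Term L V)) := Setoid T

/-- No class contains two distinct constants. -/
def Admissible {T : Set (Term L V)} (P : TermPartition T) : Prop :=
  ∀ (c d : L.Constants) (hc : Term.const c ∈ T) (hd : Term.const d ∈ T),
    P ⟨.const c, hc⟩ ⟨.const d, hd⟩ → c = d

/-- `s` is a substitution associated with the partition `P` of `T`: it sends all the elements of a
class to one selected element of this class, and it does not affect the variables outside `T`.
(Constants being fixed by every substitution, a constant is selected as soon as the class contains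
one.) -/
structure IsAssociated {T : Set (Term L V)} (P : TermPartition T) (s : Subst L V) : Prop where
  mem_class : ∀ t : T, ∃ h : t.1.subst s ∈ T, P t ⟨t.1.subst s, h⟩
  eq_of_rel : ∀ t t' : T, P t t' → t.1.subst s = t'.1.subst s
  outside : ∀ x : V, Term.var x ∉ T → s x = Term.var x

/-- Every admissible partition has an associated substitution. -/
theorem exists_isAssociated {T : Set (Term L V)} (P : TermPartition T) (hP : Admissible P) :
    ∃ s : Subst L V, IsAssociated P s := by
  classical
  have key : ∀ t : T, ∃ r : T, P t r ∧
      ((∃ c : L.Constants, ∃ hc : Term.const c ∈ T, P t ⟨.const c, hc⟩) →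
        ∃ c : L.Constants, r.1 = .const c) := by
    intro t
    by_cases h : ∃ c : L.Constants, ∃ hc : Term.const c ∈ T, P t ⟨.const c, hc⟩
    · obtain ⟨c, hc, hr⟩ := h
      exact ⟨⟨.const c, hc⟩, hr, fun _ => ⟨c, rfl⟩⟩
    · exact ⟨t, P.refl t, fun h' => absurd h' h⟩
  choose g hg hgc using key
  let q : T → T := fun t => g (Quotient.mk P t).out
  have hq : ∀ t, P t (q t) := fun t =>
    P.trans (P.symm (Quotient.exact (Quotient.out_eq (Quotient.mk P t)))) (hg _)
  have hqq : ∀ t t', P t t' → q t = q t' := fun t t' h => by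
    have : Quotient.mk P t = Quotient.mk P t' := Quotient.sound h
    simp only [q, this]
  let s : Subst L V := fun x => if h : Term.var x ∈ T then (q ⟨.var x, h⟩).1 else .var x
  have hs : ∀ t : T, t.1.subst s = (q t).1 := by
    rintro ⟨t, ht⟩
    cases t with
    | var x => simp [Term.subst, s, ht]
    | const c =>
      have h1 : P (Quotient.mk P (⟨.const c, ht⟩ : T)).out ⟨.const c, ht⟩ :=
        Quotient.exact (Quotient.out_eq (Quotient.mk P (⟨.const c, ht⟩ : T)))
      obtain ⟨d, hd⟩ := hgc _ ⟨c, ht, h1⟩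
      have hd' : Term.const d ∈ T := hd ▸ (q ⟨.const c, ht⟩).2
      have h2 : P ⟨.const c, ht⟩ ⟨.const d, hd'⟩ := by
        have h3 := hq ⟨.const c, ht⟩
        have h4 : q ⟨.const c, ht⟩ = ⟨.const d, hd'⟩ := Subtype.ext hd
        rwa [h4] at h3
      have h5 := hP c d ht hd' h2
      subst h5
      exact hd.symm
  refine ⟨s, ⟨fun t => ⟨(hs t).symm ▸ (q t).2, ?_⟩, fun t t' h => ?_, fun x hx => ?_⟩⟩
  · have : (⟨t.1.subst s, (hs t).symm ▸ (q t).2⟩ : T) = q t := Subtype.ext (hs t)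
    rw [this]
    exact hq t
  · rw [hs, hs, hqq t t' h]
  · simp [s, hx]

open scoped Classical in
/-- The separating variables of `Qs ⊆ Q`: those occurring in both `Qs` and `Q \ Qs`. -/
def sep (Q Qs : Query L V) : Set V := Query.vars Qs ∩ Query.vars (Q \ Qs)

/-- `(Qs, Hs, P)` is a piece-unifier of `Q` with `R` (where `Q` and `R` are assumed to have disjoint
sets of variables). -/
structure IsPieceUnifier (Q : Query L V) (R : Rule L V) (Qs Hs : Query L V)
    (P : TermPartition (Query.terms Qs ∪ Query.terms Hs)) : Prop where
  nonempty : Qs.Nonempty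
  sub_query : Qs ⊆ Q
  sub_head : Hs ⊆ R.head
  admissible : Admissible P
  existential : ∀ y ∈ R.exVars, ∀ hy : Term.var y ∈ Query.terms Qs ∪ Query.terms Hs,
    ∀ t, P ⟨.var y, hy⟩ t → t.1 = Term.var y ∨ ∃ x ∈ Query.vars Qs \ sep Q Qs, t.1 = Term.var x
  unifies : ∀ s : Subst L V, IsAssociated P s → Query.subst s Hs = Query.subst s Qs

/-- `(Qs, Hs, P)` is a most general piece-unifier of `Q` with `R`: it is a piece-unifier, and no
piece-unifier on the same sets `Qs` and `Hs` is strictly more general, i.e. has a strictly finer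
partition. -/
def IsMostGeneralPieceUnifier (Q : Query L V) (R : Rule L V) (Qs Hs : Query L V)
    (P : TermPartition (Query.terms Qs ∪ Query.terms Hs)) : Prop :=
  Minimal (IsPieceUnifier Q R Qs Hs) P

open scoped Classical in
/-- The one-step piece-rewriting `s(body R) ∪ s(Q \ Qs)` of `Q` according to a piece-unifier
`(Qs, Hs, P)` of `Q` with `R`, where `s` is a substitution associated with `P`. -/
noncomputable def pieceRewriting (Q : Query L V) (R : Rule L V) (Qs : Query L V)
    (s : Subst L V) : Query L V :=
  Query.subst s R.body ∪ Query.subst s (Q \ Qs)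

/-- The piece-based rewriting operator: all the one-step piece-rewritings of `Q` according to a
piece-unifier of `Q` with a rule of `𝓡`, whose variables are renamed apart from those of `Q`. -/
def pieceRew : RewOp L V := fun Q 𝓡 =>
  {Q' | ∃ R ∈ 𝓡, ∃ R', Rule.IsCopy R R' ∧ Disjoint (Query.vars Q) R'.vars ∧
    ∃ Qs Hs P, IsPieceUnifier Q R' Qs Hs P ∧
      ∃ s, IsAssociated P s ∧ Q' = pieceRewriting Q R' Qs s}

/-- The piece-based rewriting operator restricted to most general piece-unifiers. -/
def mgPieceRew : RewOp L V := fun Q 𝓡 =>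
  {Q' | ∃ R ∈ 𝓡, ∃ R', Rule.IsCopy R R' ∧ Disjoint (Query.vars Q) R'.vars ∧
    ∃ Qs Hs P, IsMostGeneralPieceUnifier Q R' Qs Hs P ∧
      ∃ s, IsAssociated P s ∧ Q' = pieceRewriting Q R' Qs s}

end PieceUnifiers

end ExistentialRules

open ExistentialRules

/-! A piece-rewriting step is a rule application read backwards. Call an assignment a fresh trigger
of a rule over a set `I` of ground atoms if it satisfies the body in `I` and sends the existential
variables to distinct elements that neither occur in `I` nor interpret a constant. Two facts about
fresh triggers carry the proof.

Backward step (`IsFreshTrigger.exists_mostGeneralPieceUnifier`): suppose that a query holds after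
such an application but the given assignment does not satisfy it in `I`. Its atoms outside `I` come
from head atoms, and grouping terms by value gives a piece-unifier; freshness yields the condition
on existential variables. A most general refinement still gives a rewriting that holds in `I`.

Converse (`IsPieceUnifier.isFreshTrigger`, `IsPieceUnifier.holdsIn_query`): with the terms
themselves as elements, an associated substitution is a fresh trigger over the atoms of the
rewriting, and applying the rule makes the query true.

If `Q₁ ≥ Q₂`, the converse makes `Q₂`, hence `Q₁`, true after the application; the backward step for
`Q₁` then gives the covering statement and prunability. Soundness uses the converse to build an
assignment in an arbitrary model. Completeness evaluates the query in the chase, where each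
application is fresh or redundant, and undoes the applications one by one until a rewriting holds in
the fact alone, which amounts to a homomorphism. -/

namespace ExistentialRules

/-! ### Substitutions, renamings and partitions of terms -/

section Syntactic

variable {L : FirstOrder.Language.{u, v}} {V : Type w}

theorem Query.terms_mono {A B : Query L V} (h : A ⊆ B) : Query.terms A ⊆ Query.terms B :=
  fun _ ⟨a, ha, i, hi⟩ => ⟨a, h ha, i, hi⟩

theorem Query.vars_mono {A B : Query L V} (h : A ⊆ B) : Query.vars A ⊆ Query.vars B :=
  fun _ hx => Query.terms_mono h hx

theorem Query.finite_terms (A : Query L V) : (Query.terms A).Finite := by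
  have : Query.terms A = ⋃ a ∈ A, Set.range a.args := by
    ext t
    simp [Query.terms]
  rw [this]
  exact A.finite_toSet.biUnion fun a _ => Set.finite_range _

theorem Query.finite_vars (A : Query L V) : (Query.vars A).Finite :=
  (Query.finite_terms A).preimage (f := Term.var) fun _ _ _ _ h => by simpa using h

theorem Rule.finite_vars (R : Rule L V) : R.vars.Finite :=
  (Query.finite_vars _).union (Query.finite_vars _)

theorem Query.mem_subst {s : Subst L V} {A : Query L V} {b : Atom L V} :
    b ∈ Query.subst s A ↔ ∃ a ∈ A, a.subst s = b := by
  simp [Query.subst]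

theorem Term.subst_subst (s t : Subst L V) (a : Term L V) :
    (a.subst s).subst t = a.subst fun x => (s x).subst t := by
  cases a <;> rfl

theorem Atom.subst_subst (s t : Subst L V) (a : Atom L V) :
    (a.subst s).subst t = a.subst fun x => (s x).subst t := by
  simp [Atom.subst, Term.subst_subst]

theorem Query.subst_subst (s t : Subst L V) (A : Query L V) :
    Query.subst t (Query.subst s A) = Query.subst (fun x => (s x).subst t) A := by
  classical
  simp only [Query.subst, Finset.image_image]
  congr 1
  funext a
  exact Atom.subst_subst s t a

theorem Query.vars_subst_rename (r : V → V) (A : Query L V) :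
    Query.vars (Query.subst (fun x => .var (r x)) A) = r '' Query.vars A := by
  ext y
  constructor
  · rintro ⟨b, hb, i, hi⟩
    obtain ⟨a, ha, rfl⟩ := Query.mem_subst.1 hb
    change (a.args i).subst _ = _ at hi
    cases h : a.args i with
    | var x =>
      rw [h] at hi
      exact ⟨x, ⟨a, ha, i, h⟩, by simpa [Term.subst] using hi⟩
    | const c =>
      rw [h] at hi
      simp [Term.subst] at hi
  · rintro ⟨x, ⟨a, ha, i, hi⟩, rfl⟩
    refine ⟨a.subst _, Query.mem_subst.2 ⟨a, ha, rfl⟩, i, ?_⟩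
    change (a.args i).subst _ = _
    rw [hi]
    rfl

theorem _root_.Set.InjOn.exists_leftInvOn {α : Type*} {r : α → α} {X : Set α}
    (h : Set.InjOn r X) : ∃ g : α → α, Set.LeftInvOn g r X := by
  rcases isEmpty_or_nonempty α with hα | hα
  · exact ⟨id, fun x => hα.elim x⟩
  · exact ⟨_, h.leftInvOn_invFunOn⟩

theorem Rule.exVars_subset_vars (R : Rule L V) : R.exVars ⊆ R.vars :=
  fun _ hx => Or.inr hx.1

theorem Rule.IsCopy.refl (R : Rule L V) : Rule.IsCopy R R := by
  classical
  refine ⟨id, Set.injOn_id _, ?_, ?_⟩ <;>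
  · have : (Atom.subst fun x : V => Term.var (id x)) = (id : Atom L V → Atom L V) := by
      funext a
      have : ∀ t : Term L V, t.subst (fun x => .var x) = t := fun t => by cases t <;> rfl
      simp [Atom.subst, this]
    rw [Query.subst, this, Finset.image_id]

theorem Rule.IsCopy.trans {R₁ R₂ R₃ : Rule L V} (h : Rule.IsCopy R₁ R₂) (h' : Rule.IsCopy R₂ R₃) :
    Rule.IsCopy R₁ R₃ := by
  obtain ⟨r, hr, hb, hh⟩ := h
  obtain ⟨q, hq, hb', hh'⟩ := h'
  refine ⟨q ∘ r, hq.comp hr fun x hx => ?_, ?_, ?_⟩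
  · simp only [Rule.vars, hb, hh, Query.vars_subst_rename, ← Set.image_union]
    exact ⟨x, hx, rfl⟩
  · rw [hb', hb, Query.subst_subst]
    rfl
  · rw [hh', hh, Query.subst_subst]
    rfl

/-- Variables of a rule can be renamed apart from any finite set of variables. -/
theorem Rule.exists_isCopy_disjoint [Infinite V] (R : Rule L V) {X : Set V} (hX : X.Finite) :
    ∃ R', Rule.IsCopy R R' ∧ Disjoint X R'.vars := by
  classical
  obtain ⟨f⟩ : Nonempty (R.vars ↪ (Xᶜ : Set V)) := by
    have := R.finite_vars.to_subtype
    have := hX.infinite_compl.to_subtype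
    obtain ⟨n, ⟨e⟩⟩ := Finite.exists_equiv_fin R.vars
    exact ⟨(e.toEmbedding.trans Fin.valEmbedding).trans (Infinite.natEmbedding _)⟩
  let r : V → V := fun x => if h : x ∈ R.vars then f ⟨x, h⟩ else x
  have hrf : ∀ x (h : x ∈ R.vars), r x = f ⟨x, h⟩ := fun x h => by simp [r, h]
  refine ⟨⟨Query.subst (fun x => .var (r x)) R.body, Query.subst (fun x => .var (r x)) R.head⟩,
    ⟨r, fun x hx y hy h => ?_, rfl, rfl⟩, ?_⟩
  · rw [hrf x hx, hrf y hy] at h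
    simpa using f.injective (Subtype.ext h)
  · rw [Set.disjoint_right]
    simp only [Rule.vars, Query.vars_subst_rename, ← Set.image_union]
    rintro _ ⟨x, hx, rfl⟩
    rw [hrf x hx]
    exact (f ⟨x, hx⟩).2

/-- The class of an existential variable `y` contains no other term of the rule, and no term of
the part of the query that is not unified. -/
theorem IsPieceUnifier.eq_of_rel_exVar {Q : Query L V} {R : Rule L V} {Qs Hs : Query L V}
    {P : TermPartition (Query.terms Qs ∪ Query.terms Hs)} (hμ : IsPieceUnifier Q R Qs Hs P)
    (hd : Disjoint (Query.vars Q) R.vars) {y : V} (hy : y ∈ R.exVars)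
    {hyT : Term.var y ∈ Query.terms Qs ∪ Query.terms Hs} {x : V}
    {hxT : Term.var x ∈ Query.terms Qs ∪ Query.terms Hs} (h : P ⟨.var y, hyT⟩ ⟨.var x, hxT⟩) :
    x = y ∨ (x ∈ Query.vars Qs ∧ x ∉ R.vars ∧ x ∉ sep Q Qs) := by
  rcases hμ.existential y hy hyT _ h with h | ⟨x', hx', h⟩
  · exact .inl (by simpa using h)
  · obtain rfl : x = x' := by simpa using h
    exact .inr ⟨hx'.1, Set.disjoint_left.1 hd (Query.vars_mono hμ.sub_query hx'.1), hx'.2⟩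

theorem IsPieceUnifier.not_rel_exVar_const {Q : Query L V} {R : Rule L V} {Qs Hs : Query L V}
    {P : TermPartition (Query.terms Qs ∪ Query.terms Hs)} (hμ : IsPieceUnifier Q R Qs Hs P)
    {y : V} (hy : y ∈ R.exVars)
    {hyT : Term.var y ∈ Query.terms Qs ∪ Query.terms Hs} {c : L.Constants}
    {hcT : Term.const c ∈ Query.terms Qs ∪ Query.terms Hs} :
    ¬ P ⟨.var y, hyT⟩ ⟨.const c, hcT⟩ := by
  intro h
  rcases hμ.existential y hy hyT _ h with h | ⟨x', hx', h⟩ <;> simp at h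

section Associated

variable {T : Set (Term L V)} {P : TermPartition T} {s : Subst L V}

/-- Classes are mapped into themselves and everything outside `T` is fixed, so no term enters or
leaves `T`. -/
theorem IsAssociated.subst_mem_iff (hs : IsAssociated P s) (t : Term L V) :
    t.subst s ∈ T ↔ t ∈ T := by
  constructor
  · intro h
    cases t with
    | var x =>
      by_contra hx
      rw [show (Term.var x).subst s = Term.var x from hs.outside x hx] at h
      exact hx h
    | const c => exact h
  · exact fun h => (hs.mem_class ⟨t, h⟩).1

theorem IsAssociated.subst_eq_self (hs : IsAssociated P s) {t : Term L V} (h : t ∉ T) :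
    t.subst s = t := by
  cases t with
  | var x => exact hs.outside x h
  | const c => rfl

theorem IsAssociated.rel_of_eq (hs : IsAssociated P s) (t t' : T)
    (h : t.1.subst s = t'.1.subst s) : P t t' := by
  obtain ⟨h1, h2⟩ := hs.mem_class t
  obtain ⟨h1', h2'⟩ := hs.mem_class t'
  refine P.trans h2 (P.symm ?_)
  convert h2' using 2

/-- If the image of a term is the image of a term of `T`, then both are in `T` and in the same
class. -/
theorem IsAssociated.exists_rel_of_eq (hs : IsAssociated P s) {t t' : Term L V} (ht : t ∈ T)
    (h : t.subst s = t'.subst s) : ∃ ht' : t' ∈ T, P ⟨t, ht⟩ ⟨t', ht'⟩ := by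
  have : t' ∈ T := by rwa [← hs.subst_mem_iff, ← h, hs.subst_mem_iff]
  exact ⟨this, hs.rel_of_eq _ _ h⟩

end Associated

/-- Every piece-unifier is refined by a most general one. -/
theorem IsPieceUnifier.exists_mostGeneral_le {Q : Query L V} {R : Rule L V} {Qs Hs : Query L V}
    {P : TermPartition (Query.terms Qs ∪ Query.terms Hs)} (hμ : IsPieceUnifier Q R Qs Hs P) :
    ∃ P' ≤ P, IsMostGeneralPieceUnifier Q R Qs Hs P' := by
  -- Finitely many terms have finitely many partitions, so there is a minimal unifying one below
  -- `P`.
  have : Finite ↥(Query.terms Qs ∪ Query.terms Hs) :=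
    ((Query.finite_terms Qs).union (Query.finite_terms Hs)).to_subtype
  have : Finite (TermPartition (Query.terms Qs ∪ Query.terms Hs)) :=
    Finite.of_injective (fun P => (P : _ → _ → Prop)) fun P P' h => Setoid.ext fun a b => by
      rw [show P a b = P' a b from congrFun (congrFun h a) b]
  exact (Set.toFinite {P | IsPieceUnifier Q R Qs Hs P}).exists_le_minimal hμ

end Syntactic

/-! ### Ground atoms, fresh rule applications and the backward step -/

section Ground

variable {L : FirstOrder.Language.{u, v}} {V : Type w} {M : Type*}

/-- An atom whose arguments are elements of `M`. -/
structure GroundAtom (L : FirstOrder.Language.{u, v}) (M : Type*) where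
  arity : ℕ
  pred : L.Relations arity
  args : Fin arity → M

/-- Value of a term, for an interpretation `k` of the constants and `e` of the variables. -/
def Term.eval (k : L.Constants → M) (e : V → M) : Term L V → M
  | .var x => e x
  | .const c => k c

/-- Value of an atom, for an interpretation `k` of the constants and `e` of the variables. -/
def Atom.eval (k : L.Constants → M) (e : V → M) (a : Atom L V) : GroundAtom L M :=
  ⟨a.arity, a.pred, fun i => (a.args i).eval k e⟩

/-- The elements occurring in a set of ground atoms. -/
def activeDomain (I : Set (GroundAtom L M)) : Set M :=
  {m | ∃ a ∈ I, ∃ i, a.args i = m}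

/-- The query `A` is true in the set of ground atoms `I` under the assignment `e`. -/
def Query.HoldsIn (k : L.Constants → M) (e : V → M) (A : Query L V)
    (I : Set (GroundAtom L M)) : Prop :=
  ∀ a ∈ A, a.eval k e ∈ I

variable {k : L.Constants → M} {e e' : V → M}

theorem Term.eval_subst (s : Subst L V) (t : Term L V) :
    (t.subst s).eval k e = t.eval k fun x => (s x).eval k e := by
  cases t <;> rfl

theorem Atom.eval_subst (s : Subst L V) (a : Atom L V) :
    (a.subst s).eval k e = a.eval k fun x => (s x).eval k e := by
  simp [Atom.eval, Atom.subst, Term.eval_subst]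

theorem Atom.eval_congr {A : Query L V} (h : ∀ x ∈ Query.vars A, e x = e' x) {a : Atom L V}
    (ha : a ∈ A) : a.eval k e = a.eval k e' := by
  unfold Atom.eval
  congr 1
  funext i
  cases hi : a.args i with
  | var x => exact h x ⟨a, ha, i, hi⟩
  | const c => rfl

theorem Query.HoldsIn.mem_activeDomain {A : Query L V} {I : Set (GroundAtom L M)}
    (h : Query.HoldsIn k e A I) {t : Term L V} (ht : t ∈ Query.terms A) :
    t.eval k e ∈ activeDomain I := by
  obtain ⟨a, ha, i, rfl⟩ := ht
  exact ⟨_, h a ha, i, rfl⟩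

theorem MoreGeneral.holdsIn {A B : Query L V} (h : MoreGeneral A B) {I : Set (GroundAtom L M)}
    (hB : Query.HoldsIn k e B I) : ∃ e', Query.HoldsIn k e' A I := by
  obtain ⟨s, hs⟩ := h
  refine ⟨fun x => (s x).eval k e, fun a ha => ?_⟩
  rw [← Atom.eval_subst]
  exact hB _ (hs (Query.mem_subst.2 ⟨a, ha, rfl⟩))

/-- Atoms with the same value are unified by `s` if `s` unifies their terms of the same value. -/
theorem Atom.subst_eq_of_eval_eq {s : Subst L V} {a b : Atom L V}
    (h : a.eval k e = b.eval k e)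
    (H : ∀ i j, (a.args i).eval k e = (b.args j).eval k e →
      (a.args i).subst s = (b.args j).subst s) : a.subst s = b.subst s := by
  obtain ⟨n, p, x⟩ := a
  obtain ⟨m, q, y⟩ := b
  simp only [Atom.eval, GroundAtom.mk.injEq] at h
  obtain ⟨rfl, h1, h2⟩ := h
  simp only [heq_eq_eq] at h1 h2
  subst h1
  simp only [Atom.subst, Atom.mk.injEq, heq_eq_eq, true_and]
  funext i
  exact H i i (congrFun h2 i)

/-- The assignment `e` satisfies the body of `R` in `I`, and it sends the existential variables of
`R` to distinct fresh elements. -/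
structure IsFreshTrigger (k : L.Constants → M) (I : Set (GroundAtom L M)) (R : Rule L V)
    (e : V → M) : Prop where
  body : Query.HoldsIn k e R.body I
  fresh : ∀ y ∈ R.exVars, e y ∉ activeDomain I
  ne_const : ∀ y ∈ R.exVars, ∀ c, e y ≠ k c
  inj : Set.InjOn e R.exVars

/-- Precomposing with an inverse of the renaming transports the trigger. One inclusion between the
head images is enough to keep a query true when `R` is replaced by a copy sharing no variable with
it. -/
theorem IsFreshTrigger.copy {I : Set (GroundAtom L M)} {R R' : Rule L V}
    (h : IsFreshTrigger k I R e) (hc : Rule.IsCopy R R') :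
    ∃ e', IsFreshTrigger k I R' e' ∧ ∀ a ∈ R.head, ∃ b ∈ R'.head, b.eval k e' = a.eval k e := by
  classical
  obtain ⟨r, hr, hb, hh⟩ := hc
  obtain ⟨g, hg⟩ := hr.exists_leftInvOn
  let e' : V → M := fun x => e (g x)
  have he' : ∀ x ∈ R.vars, e' (r x) = e x := fun x hx => by
    simp only [e', hg hx]
  have hex : ∀ y ∈ R'.exVars, ∃ x ∈ R.exVars, r x = y := by
    rintro y ⟨hy1, hy2⟩
    rw [hh, Query.vars_subst_rename] at hy1
    rw [hb, Query.vars_subst_rename] at hy2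
    obtain ⟨x, hx, rfl⟩ := hy1
    exact ⟨x, ⟨hx, fun h => hy2 ⟨x, h, rfl⟩⟩, rfl⟩
  have hsub := R.exVars_subset_vars
  refine ⟨e', ⟨fun a ha => ?_, fun y hy => ?_, fun y hy => ?_, fun y hy y' hy' => ?_⟩,
    fun a ha => ?_⟩
  · rw [hb] at ha
    obtain ⟨b, hbR, rfl⟩ := Query.mem_subst.1 ha
    rw [Atom.eval_subst]
    change b.eval k (fun x => e' (r x)) ∈ I
    rw [Atom.eval_congr (e' := e) (fun x hx => he' x (Or.inl hx)) hbR]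
    exact h.body b hbR
  · obtain ⟨x, hx, rfl⟩ := hex y hy
    rw [he' x (hsub hx)]
    exact h.fresh x hx
  · obtain ⟨x, hx, rfl⟩ := hex y hy
    rw [he' x (hsub hx)]
    exact h.ne_const x hx
  · obtain ⟨x, hx, rfl⟩ := hex y hy
    obtain ⟨x', hx', rfl⟩ := hex y' hy'
    rw [he' x (hsub hx), he' x' (hsub hx')]
    exact fun heq => congrArg r (h.inj hx hx' heq)
  · refine ⟨_, by rw [hh]; exact Query.mem_subst.2 ⟨a, ha, rfl⟩, ?_⟩
    rw [Atom.eval_subst]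
    exact Atom.eval_congr (fun x hx => he' x (Or.inr hx)) ha

theorem IsAssociated.eval_subst {T : Set (Term L V)} {P : TermPartition T} {s : Subst L V}
    (hs : IsAssociated P s) (hP : ∀ t t', P t t' → t.1.eval k e = t'.1.eval k e)
    (t : Term L V) : (t.subst s).eval k e = t.eval k e := by
  by_cases ht : t ∈ T
  · obtain ⟨h, hr⟩ := hs.mem_class ⟨t, ht⟩
    exact (hP _ _ hr).symm
  · rw [hs.subst_eq_self ht]

/-- The backward step: if a query is true after the application of a rule whose existential
variables are sent to fresh elements, then it was true before this application, or it has a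
piece-rewriting that was. -/
theorem IsFreshTrigger.exists_mostGeneralPieceUnifier (hk : Function.Injective k)
    {I : Set (GroundAtom L M)} {R : Rule L V} {σ : V → M} (hσ : IsFreshTrigger k I R σ)
    {Q : Query L V} (hd : Disjoint (Query.vars Q) R.vars)
    (hQ : Query.HoldsIn k e Q (I ∪ Atom.eval k σ '' R.head)) :
    Query.HoldsIn k e Q I ∨
      ∃ (Qs Hs : Query L V) (P : TermPartition (Query.terms Qs ∪ Query.terms Hs)),
        IsMostGeneralPieceUnifier Q R Qs Hs P ∧ ∃ f, ∀ s, IsAssociated P s →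
          Query.HoldsIn k f (pieceRewriting Q R Qs s) I := by
  classical
  by_cases hQI : Query.HoldsIn k e Q I
  · exact .inl hQI
  right
  -- As `Q` and `R` share no variable, a single assignment can play the roles of `σ` and `e`.
  let f : V → M := fun x => if x ∈ R.vars then σ x else e x
  have hfR : ∀ x ∈ R.vars, f x = σ x := fun x hx => if_pos hx
  have hfQ : ∀ x ∈ Query.vars Q, f x = e x := fun x hx => if_neg (Set.disjoint_left.1 hd hx)
  have hf : IsFreshTrigger k I R f := by
    have hsub := R.exVars_subset_vars
    refine ⟨fun a ha => ?_, fun y hy => ?_, fun y hy => ?_, fun y hy y' hy' => ?_⟩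
    · rw [Atom.eval_congr (fun x hx => hfR x (Or.inl hx)) ha]
      exact hσ.body a ha
    · rw [hfR y (hsub hy)]
      exact hσ.fresh y hy
    · rw [hfR y (hsub hy)]
      exact hσ.ne_const y hy
    · rw [hfR y (hsub hy), hfR y' (hsub hy')]
      exact hσ.inj hy hy'
  -- The part to unify consists of the atoms that only the rule application made true.
  let Qs : Query L V := Q.filter fun a => a.eval k f ∉ I
  let Hs : Query L V := R.head.filter fun b => ∃ a ∈ Qs, a.eval k f = b.eval k f
  have hQs : Qs ⊆ Q := Finset.filter_subset _ _
  have hHs : Hs ⊆ R.head := Finset.filter_subset _ _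
  have hrest : Query.HoldsIn k f (Q \ Qs) I := fun a ha => by
    by_contra h
    rw [Finset.mem_sdiff] at ha
    exact ha.2 (Finset.mem_filter.2 ⟨ha.1, h⟩)
  have hmatch : ∀ a ∈ Qs, ∃ b ∈ Hs, a.eval k f = b.eval k f := fun a ha => by
    obtain ⟨haQ, haI⟩ := Finset.mem_filter.1 ha
    have h := hQ a haQ
    rw [← Atom.eval_congr hfQ haQ] at h
    obtain ⟨b, hb, hba⟩ := h.resolve_left haI
    rw [← Atom.eval_congr (fun x hx => hfR x (Or.inr hx)) hb] at hba
    exact ⟨b, Finset.mem_filter.2 ⟨hb, a, ha, hba.symm⟩, hba.symm⟩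
  -- Two terms are in the same class when they have the same value; injectivity of `k` makes this
  -- admissible.
  let P : TermPartition (Query.terms Qs ∪ Query.terms Hs) :=
    Setoid.ker fun t => t.1.eval k f
  have hμ : IsPieceUnifier Q R Qs Hs P := by
    refine ⟨?_, hQs, hHs, fun c d hc hd h => hk h, fun y hy hyT t ht => ?_, fun s hs => ?_⟩
    · by_contra hne
      rw [Finset.not_nonempty_iff_eq_empty] at hne
      refine hQI fun a ha => ?_
      rw [← Atom.eval_congr hfQ ha]
      exact hrest a (by simpa [hne] using ha)
    · obtain ⟨t, htT⟩ := t
      replace ht : f y = t.eval k f := ht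
      cases t with
      | const c => exact absurd ht (hf.ne_const y hy c)
      | var x =>
        replace ht : f y = f x := ht
        rcases htT with hx | hx
        -- A separating variable occurs in `Q \ Qs`, which holds in `I`, so its value cannot be
        -- fresh.
        · refine .inr ⟨x, ⟨hx, fun hsep => hf.fresh y hy ?_⟩, rfl⟩
          rw [ht]
          exact hrest.mem_activeDomain hsep.2
        -- A frontier variable has its value in `I`, so it differs from `y`; another existential
        -- variable differs by injectivity.
        · by_cases hxb : x ∈ Query.vars R.body
          · refine absurd ?_ (hf.fresh y hy)
            rw [ht]
            exact hf.body.mem_activeDomain hxb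
          · exact .inl (congrArg Term.var (hf.inj hy ⟨Query.vars_mono hHs hx, hxb⟩ ht).symm)
    · have key : ∀ a ∈ Qs, ∀ b ∈ Hs, a.eval k f = b.eval k f → a.subst s = b.subst s :=
        fun a ha b hb h => Atom.subst_eq_of_eval_eq h fun i j hij =>
          hs.eq_of_rel ⟨_, Or.inl ⟨a, ha, i, rfl⟩⟩ ⟨_, Or.inr ⟨b, hb, j, rfl⟩⟩ hij
      ext c
      simp only [Query.mem_subst]
      constructor
      · rintro ⟨b, hb, rfl⟩
        obtain ⟨a, ha, hab⟩ := (Finset.mem_filter.1 hb).2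
        exact ⟨a, ha, key a ha b hb hab⟩
      · rintro ⟨a, ha, rfl⟩
        obtain ⟨b, hb, hab⟩ := hmatch a ha
        exact ⟨b, hb, (key a ha b hb hab).symm⟩
  obtain ⟨P', hP', hmin⟩ := hμ.exists_mostGeneral_le
  refine ⟨Qs, Hs, P', hmin, f, fun s hs c hc => ?_⟩
  -- The classes of `P'` lie inside those of `P`, so `s` only replaces terms by terms of equal
  -- value.
  have heval : ∀ a : Atom L V, (a.subst s).eval k f = a.eval k f := fun a => by
    unfold Atom.eval Atom.subst
    congr 1
    funext i
    exact hs.eval_subst (fun t t' h => hP' h) _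
  rcases Finset.mem_union.1 hc with hc | hc <;> obtain ⟨a, ha, rfl⟩ := Query.mem_subst.1 hc <;>
    rw [heval]
  · exact hf.body a ha
  · exact hrest a (by convert ha)

/-- Read backwards, a piece-rewriting step is the application of a rule whose existential variables
are sent to fresh terms. -/
theorem IsPieceUnifier.isFreshTrigger {Q : Query L V} {R : Rule L V} {Qs Hs : Query L V}
    {P : TermPartition (Query.terms Qs ∪ Query.terms Hs)} (hμ : IsPieceUnifier Q R Qs Hs P)
    (hd : Disjoint (Query.vars Q) R.vars) {s : Subst L V} (hs : IsAssociated P s) :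
    IsFreshTrigger Term.const (Atom.eval .const .var '' (pieceRewriting Q R Qs s)) R s := by
  classical
  have heval : ∀ t : Term L V, t.eval .const s = t.subst s := fun t => by cases t <;> rfl
  have heval' : ∀ t : Term L V, t.eval .const .var = t := fun t => by cases t <;> rfl
  have hsub := R.exVars_subset_vars
  -- Only `y` itself and non-separating variables of `Qs` can share the image of `y`. None of the
  -- latter occurs in the body or in `Q \ Qs`, whence freshness.
  have hmain : ∀ y ∈ R.exVars, ∀ t : Term L V, s y = t.subst s →
      t = .var y ∨ ∃ x, t = .var x ∧ x ∈ Query.vars Qs ∧ x ∉ R.vars ∧ x ∉ sep Q Qs := by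
    intro y hy t h
    by_cases hyT : Term.var y ∈ Query.terms Qs ∪ Query.terms Hs
    · obtain ⟨htT, hr⟩ := hs.exists_rel_of_eq (t := .var y) hyT h
      cases t with
      | const c => exact absurd hr (hμ.not_rel_exVar_const hy)
      | var x =>
        rcases hμ.eq_of_rel_exVar hd hy hr with rfl | h
        · exact .inl rfl
        · exact .inr ⟨x, rfl, h⟩
    · rw [hs.outside y hyT] at h
      have htT : t ∉ Query.terms Qs ∪ Query.terms Hs := by
        rwa [← hs.subst_mem_iff, ← h]
      rw [hs.subst_eq_self htT] at h
      exact .inl h.symm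
  refine ⟨fun a ha => ⟨a.subst s, ?_, ?_⟩, fun y hy => ?_, fun y hy c hc => ?_,
    fun y hy y' hy' h => ?_⟩
  · exact Finset.mem_union_left _ (Query.mem_subst.2 ⟨a, ha, rfl⟩)
  · rw [Atom.eval_subst]
    simp only [heval']
  · rintro ⟨_, ⟨b, hb, rfl⟩, i, hi⟩
    change (b.args i).eval _ _ = _ at hi
    rw [heval'] at hi
    rcases Finset.mem_union.1 hb with hb | hb <;> obtain ⟨a, ha, rfl⟩ := Query.mem_subst.1 hb
    · change (a.args i).subst s = _ at hi
      rcases hmain y hy _ hi.symm with h | ⟨x, h, -, hx, -⟩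
      · exact hy.2 ⟨a, ha, i, h⟩
      · exact hx (Or.inl ⟨a, ha, i, h⟩)
    · change (a.args i).subst s = _ at hi
      have hrest : Q \ Qs ⊆ Q := Finset.sdiff_subset
      rcases hmain y hy _ hi.symm with h | ⟨x, h, hxQ, -, hx⟩
      · refine Set.disjoint_left.1 hd (Query.vars_mono hrest ⟨a, ?_, i, h⟩) (hsub hy)
        convert ha
      · exact hx ⟨hxQ, ⟨a, ha, i, h⟩⟩
  · rcases hmain y hy (.const c) hc with h | ⟨x, h, -⟩ <;> cases h
  · rcases hmain y hy (.var y') h with h | ⟨x, h, -, hx, -⟩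
    · simpa using h.symm
    · obtain rfl : y' = x := by simpa using h
      exact absurd (hsub hy') hx

/-- Unification puts the image of `Qs` among the images of head atoms, and the image of the rest of
`Q` is part of the rewriting. -/
theorem IsPieceUnifier.holdsIn_query {Q : Query L V} {R : Rule L V} {Qs Hs : Query L V}
    {P : TermPartition (Query.terms Qs ∪ Query.terms Hs)} (hμ : IsPieceUnifier Q R Qs Hs P)
    {s : Subst L V} (hs : IsAssociated P s) :
    Query.HoldsIn Term.const s Q (Atom.eval .const .var '' (pieceRewriting Q R Qs s) ∪
      Atom.eval .const s '' R.head) := by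
  classical
  have heval' : ∀ t : Term L V, t.eval .const .var = t := fun t => by cases t <;> rfl
  have key : ∀ a : Atom L V, (a.subst s).eval .const .var = a.eval .const s := fun a => by
    rw [Atom.eval_subst]
    simp only [heval']
  intro a ha
  by_cases haQ : a ∈ Qs
  · right
    have : a.subst s ∈ Query.subst s Hs := by
      rw [hμ.unifies s hs]
      exact Query.mem_subst.2 ⟨a, haQ, rfl⟩
    obtain ⟨b, hb, hba⟩ := Query.mem_subst.1 this
    exact ⟨b, hμ.sub_head hb, by rw [← key, ← key, hba]⟩
  · left
    refine ⟨a.subst s, Finset.mem_union_right _ (Query.mem_subst.2 ⟨a, ?_, rfl⟩), key a⟩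
    exact Finset.mem_sdiff.2 ⟨ha, haQ⟩

theorem Atom.eval_const_injective :
    Function.Injective (Atom.eval (L := L) (V := V) Term.const Term.var) := by
  have heval' : ∀ t : Term L V, t.eval .const .var = t := fun t => by cases t <;> rfl
  rintro ⟨n, p, x⟩ ⟨m, q, y⟩ h
  simp only [Atom.eval, heval', GroundAtom.mk.injEq] at h
  obtain ⟨rfl, h1, h2⟩ := h
  simp only [heq_eq_eq] at h1 h2
  obtain rfl : x = y := h2
  rw [h1]

/-- With terms as elements and constants denoting themselves, an assignment is a substitution and
truth is a homomorphism. -/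
theorem Query.moreGeneral_of_holdsIn {A B : Query L V} {f : Subst L V}
    (h : Query.HoldsIn Term.const f A (Atom.eval .const .var '' (B : Set (Atom L V)))) :
    MoreGeneral A B := by
  refine ⟨f, fun c hc => ?_⟩
  obtain ⟨a, ha, rfl⟩ := Query.mem_subst.1 hc
  obtain ⟨b, hb, hba⟩ := h a ha
  have heval' : ∀ t : Term L V, t.eval .const .var = t := fun t => by cases t <;> rfl
  have : (a.subst f).eval .const .var = a.eval .const f := by
    rw [Atom.eval_subst]
    simp only [heval']
  rw [← this] at hba
  rw [← Atom.eval_const_injective hba]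
  exact hb

/-- A piece-rewriting step of a query `Q₂` with a rule is covered by any more general query `Q₁`, or
by a piece-rewriting step of `Q₁` with a copy of this rule. -/
theorem IsPieceUnifier.lift {Q₁ Q₂ : Query L V} {R R' : Rule L V} (hR : Rule.IsCopy R R')
    (hd₁ : Disjoint (Query.vars Q₁) R'.vars) (hd₂ : Disjoint (Query.vars Q₂) R.vars)
    (hQ : MoreGeneral Q₁ Q₂) {Qs₂ Hs₂ : Query L V}
    {P₂ : TermPartition (Query.terms Qs₂ ∪ Query.terms Hs₂)}
    (hμ : IsPieceUnifier Q₂ R Qs₂ Hs₂ P₂) {s₂ : Subst L V} (hs₂ : IsAssociated P₂ s₂) :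
    MoreGeneral Q₁ (pieceRewriting Q₂ R Qs₂ s₂) ∨
      ∃ (Qs₁ Hs₁ : Query L V) (P₁ : TermPartition (Query.terms Qs₁ ∪ Query.terms Hs₁)),
        IsMostGeneralPieceUnifier Q₁ R' Qs₁ Hs₁ P₁ ∧ ∀ s₁ : Subst L V, IsAssociated P₁ s₁ →
          MoreGeneral (pieceRewriting Q₁ R' Qs₁ s₁) (pieceRewriting Q₂ R Qs₂ s₂) := by
  -- The rewriting of `Q₂` serves as the set of ground atoms to which the rule is applied; the
  -- backward step is then taken for `Q₁`.
  obtain ⟨σ, hσ, hhead⟩ := (hμ.isFreshTrigger hd₂ hs₂).copy hR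
  obtain ⟨e, he⟩ := hQ.holdsIn (hμ.holdsIn_query hs₂)
  have he' : Query.HoldsIn Term.const e Q₁ (Atom.eval .const .var ''
      (pieceRewriting Q₂ R Qs₂ s₂) ∪ Atom.eval .const σ '' R'.head) := by
    intro a ha
    rcases he a ha with h | ⟨b, hb, hba⟩
    · exact .inl h
    · obtain ⟨b', hb', hbb⟩ := hhead b hb
      exact .inr ⟨b', hb', hbb.trans hba⟩
  rcases hσ.exists_mostGeneralPieceUnifier (fun c d h => by simpa using h) hd₁ he' with
    h | ⟨Qs, Hs, P, hP, f, hf⟩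
  · exact .inl (Query.moreGeneral_of_holdsIn h)
  · exact .inr ⟨Qs, Hs, P, hP, fun s hs => Query.moreGeneral_of_holdsIn (hf s hs)⟩

end Ground

/-! ### Soundness of piece-rewriting in arbitrary models -/

section Soundness

variable {L : FirstOrder.Language.{u, v}} {V : Type w} {M : Type*} [L.Structure M]

theorem Term.val_subst (e : V → M) (s : Subst L V) (t : Term L V) :
    (t.subst s).val e = t.val fun x => (s x).val e := by
  cases t <;> rfl

theorem Query.holds_subst {e : V → M} {s : Subst L V} {A : Query L V} :
    Query.Holds e (Query.subst s A) ↔ Query.Holds (fun x => (s x).val e) A := by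
  simp only [Query.Holds, Query.mem_subst, forall_exists_index, and_imp, forall_apply_eq_imp_iff₂]
  refine forall₂_congr fun a _ => ?_
  change FirstOrder.Language.Structure.RelMap a.pred (fun i => ((a.args i).subst s).val e) ↔ _
  simp only [Term.val_subst]

theorem Query.Holds.congr {e e' : V → M} {A : Query L V} (h : Query.Holds e A)
    (he : ∀ x ∈ Query.vars A, e x = e' x) : Query.Holds e' A := by
  intro a ha
  convert h a ha using 2 with i
  cases hi : a.args i with
  | var x => exact (he x ⟨a, ha, i, hi⟩).symm
  | const c => rfl

theorem Query.Sat.of_moreGeneral {A B : Query L V} (h : MoreGeneral A B) (hB : Query.Sat M B) :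
    Query.Sat M A := by
  obtain ⟨s, hs⟩ := h
  obtain ⟨e, he⟩ := hB
  exact ⟨_, Query.holds_subst.1 fun a ha => he a (hs ha)⟩

theorem Rule.Sat.copy {R R' : Rule L V} (h : Rule.Sat M R) (hc : Rule.IsCopy R R') :
    Rule.Sat M R' := by
  classical
  obtain ⟨r, hr, hb, hh⟩ := hc
  intro e he
  obtain ⟨g, hg⟩ := hr.exists_leftInvOn
  rw [hb, Query.holds_subst] at he
  obtain ⟨e', hag, he'⟩ := h _ he
  have hinv : ∀ x ∈ R.vars, e' (g (r x)) = e' x := fun x hx => by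
    rw [hg hx]
  refine ⟨fun y => e' (g y), fun y hy => ?_, ?_⟩
  · rw [hb, Query.vars_subst_rename] at hy
    obtain ⟨x, hx, rfl⟩ := hy
    exact (hinv x (Or.inl hx)).trans (hag x hx)
  · rw [hh, Query.holds_subst]
    exact he'.congr fun x hx => (hinv x (Or.inr hx)).symm

/-- A model of a rule that satisfies a piece-rewriting of `Q` with this rule satisfies `Q`. -/
theorem IsPieceUnifier.sat {Q : Query L V} {R : Rule L V} {Qs Hs : Query L V}
    {P : TermPartition (Query.terms Qs ∪ Query.terms Hs)} (hμ : IsPieceUnifier Q R Qs Hs P)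
    (hd : Disjoint (Query.vars Q) R.vars) {s : Subst L V} (hs : IsAssociated P s)
    (hR : Rule.Sat M R) (h : Query.Sat M (pieceRewriting Q R Qs s)) : Query.Sat M Q := by
  classical
  obtain ⟨e, he⟩ := h
  have hbody : Query.Holds (fun x => (s x).val e) R.body :=
    Query.holds_subst.1 fun a ha => he a (Finset.mem_union_left _ ha)
  have hrest : Query.Holds (fun x => (s x).val e) (Q \ Qs) :=
    Query.holds_subst.1 fun a ha => he a (Finset.mem_union_right _ (by convert ha))
  obtain ⟨e', hag, hhead⟩ := hR _ hbody
  have hfresh := hμ.isFreshTrigger hd hs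
  -- Variables unified with an existential variable `y` take the witness `e' y` supplied by the
  -- rule; the others keep their value through `s`. Injectivity of `s` on existential variables
  -- makes the choice of `y` unambiguous.
  let f : V → M := fun x =>
    if h : ∃ y ∈ R.exVars, s y = s x then e' h.choose else (s x).val e
  have hf : ∀ x, ∀ y ∈ R.exVars, s y = s x → f x = e' y := fun x y hy hyx => by
    have h : ∃ y ∈ R.exVars, s y = s x := ⟨y, hy, hyx⟩
    have : h.choose = y := hfresh.inj h.choose_spec.1 hy (h.choose_spec.2.trans hyx.symm)
    simp only [f, dif_pos h, this]
  have hf' : ∀ x, (∀ y ∈ R.exVars, s y ≠ s x) → f x = (s x).val e := fun x hx =>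
    dif_neg fun ⟨y, hy, hyx⟩ => hx y hy hyx
  refine ⟨f, fun a ha => ?_⟩
  by_cases haQ : a ∈ Qs
  · have : a.subst s ∈ Query.subst s Hs := by
      rw [hμ.unifies s hs]
      exact Query.mem_subst.2 ⟨a, haQ, rfl⟩
    obtain ⟨b, hb, hba⟩ := Query.mem_subst.1 this
    have hb' := hhead b (hμ.sub_head hb)
    have hvars : ∀ i x, b.args i = .var x → x ∈ Query.vars R.head := fun i x hx =>
      ⟨b, hμ.sub_head hb, i, hx⟩
    clear ha haQ this hb
    obtain ⟨n, p, x⟩ := a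
    obtain ⟨m, q, y⟩ := b
    simp only [Atom.subst, Atom.mk.injEq] at hba
    obtain ⟨rfl, h1, h2⟩ := hba
    simp only [heq_eq_eq] at h1 h2
    subst h1
    convert hb' using 2 with i
    have hi : (y i).subst s = (x i).subst s := congrFun h2 i
    have hvi := hvars i
    change (x i).val f = (y i).val e'
    change ∀ z, y i = .var z → _ at hvi
    generalize x i = t at hi ⊢
    generalize y i = t' at hi hvi ⊢
    -- A frontier variable occurs in the body, so its image occurs in the rewriting and is not that
    -- of an existential variable.
    have hval : ∀ z ∈ Query.vars R.head, (∃ y ∈ R.exVars, s y = s z) → z ∈ R.exVars := by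
      rintro z hz ⟨y, hy, hyz⟩
      by_contra hzx
      have hzb : z ∈ Query.vars R.body := by
        by_contra hzb
        exact hzx ⟨hz, hzb⟩
      refine hfresh.fresh y hy ?_
      rw [hyz]
      exact hfresh.body.mem_activeDomain hzb
    have key : (∀ y ∈ R.exVars, s y ≠ t'.subst s) → t'.val e' = (t'.subst s).val e := by
      intro hne
      cases t' with
      | const c => rfl
      | var z =>
        refine hag z ?_
        by_contra hzb
        exact hne z ⟨hvi z rfl, hzb⟩ rfl
    by_cases hex : ∃ y ∈ R.exVars, s y = t'.subst s
    · obtain ⟨y, hy, hyt⟩ := hex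
      cases t' with
      | const c => exact absurd hyt (hfresh.ne_const y hy c)
      | var z =>
        have hz := hval z (hvi z rfl) ⟨y, hy, hyt⟩
        cases t with
        | const c => exact absurd hi (hfresh.ne_const z hz c)
        | var w => exact hf w z hz hi
    · push Not at hex
      rw [key hex, hi]
      rw [hi] at hex
      cases t with
      | const c => rfl
      | var w => exact hf' w hex
  · have ha' : a ∈ Q \ Qs := Finset.mem_sdiff.2 ⟨ha, haQ⟩
    refine hrest.congr (fun x hx => ?_) a ha'
    refine (hf' x fun y hy hyx => hfresh.fresh y hy ?_).symm
    obtain ⟨b, hb, i, hi⟩ := hx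
    refine ⟨_, ⟨b.subst s, Finset.mem_union_right _ (Query.mem_subst.2 ⟨b, by convert hb, rfl⟩),
      rfl⟩, i, ?_⟩
    change ((b.args i).subst s).eval _ _ = _
    rw [hi, hyx]
    change (s x).eval _ _ = _
    cases s x <;> rfl

theorem mgPieceRew_subset (Q : Query L V) (𝓡 : Set (Rule L V)) :
    (mgPieceRew : RewOp L V) Q 𝓡 ⊆ (pieceRew : RewOp L V) Q 𝓡 := by
  rintro _ ⟨R, hR, R', hc, hd, Qs, Hs, P, hP, s, hs, rfl⟩
  exact ⟨R, hR, R', hc, hd, Qs, Hs, P, hP.prop, s, hs, rfl⟩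

theorem sat_of_mem_pieceRew {Q Q' : Query L V} {𝓡 : Set (Rule L V)}
    (hQ' : Q' ∈ (pieceRew : RewOp L V) Q 𝓡) (h𝓡 : ∀ R ∈ 𝓡, Rule.Sat M R)
    (h : Query.Sat M Q') : Query.Sat M Q := by
  obtain ⟨R, hR, R', hc, hd, Qs, Hs, P, hP, s, hs, rfl⟩ := hQ'
  exact hP.sat hd hs ((h𝓡 R hR).copy hc) h

theorem sat_of_mem_iter_pieceRew {Q : Query L V} {𝓡 : Set (Rule L V)}
    (h𝓡 : ∀ R ∈ 𝓡, Rule.Sat M R) {n : ℕ} {Q' : Query L V}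
    (hQ' : Q' ∈ (pieceRew : RewOp L V).iter Q 𝓡 n) (h : Query.Sat M Q') : Query.Sat M Q := by
  induction n generalizing Q' with
  | zero =>
    obtain rfl : Q' = Q := hQ'
    exact h
  | succ n ih =>
    obtain ⟨Q'', hQ'', hmem⟩ := hQ'
    exact ih hQ'' (sat_of_mem_pieceRew hmem h𝓡 h)

end Soundness

/-! ### The chase and completeness -/

section Chase

variable {L : FirstOrder.Language.{u, v}} {V : Type w}

/-- `iter` adds steps at the end, whereas undoing the last chase application produces the first
rewriting step. -/
theorem RewOp.mem_iter_succ_of_mem {rew : RewOp L V} {Q Q' Q'' : Query L V} {𝓡 : Set (Rule L V)}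
    (hQ' : Q' ∈ rew Q 𝓡) {n : ℕ} (hQ'' : Q'' ∈ rew.iter Q' 𝓡 n) : Q'' ∈ rew.iter Q 𝓡 (n + 1) := by
  induction n generalizing Q'' with
  | zero =>
    obtain rfl : Q'' = Q' := hQ''
    exact ⟨Q, rfl, hQ'⟩
  | succ n ih =>
    obtain ⟨Q₁, h, h'⟩ := hQ''
    exact ⟨Q₁, ih h, h'⟩

theorem RewOp.iter_mono {rew rew' : RewOp L V} (h : ∀ Q 𝓡, rew Q 𝓡 ⊆ rew' Q 𝓡) (Q : Query L V)
    (𝓡 : Set (Rule L V)) (n : ℕ) : rew.iter Q 𝓡 n ⊆ rew'.iter Q 𝓡 n := by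
  induction n with
  | zero => exact subset_rfl
  | succ n ih =>
    rintro Q'' ⟨Q', hQ', hmem⟩
    exact ⟨Q', ih hQ', h _ _ hmem⟩

/-- Elements of the chase: the terms, and for each rule `R` and assignment `σ` of its variables a
null for every variable of `R`. -/
inductive ChaseTerm (L : FirstOrder.Language.{u, v}) (V : Type w) : Type (max u v w)
  | base (t : Term L V) : ChaseTerm L V
  | null (R : Rule L V) (σ : V → ChaseTerm L V) (z : V) : ChaseTerm L V

namespace ChaseTerm

/-- Interpretation of the constants in the chase. -/
def const (c : L.Constants) : ChaseTerm L V := base (.const c)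

/-- Interpretation of the variables of the initial fact in the chase. -/
def var (x : V) : ChaseTerm L V := base (.var x)

theorem const_injective : Function.Injective (const : L.Constants → ChaseTerm L V) :=
  fun c d h => by simpa [const] using h

open scoped Classical in
/-- The assignment that sends the variables outside the body of `R` to the nulls of `R` and `σ`. -/
noncomputable def extend (R : Rule L V) (σ : V → ChaseTerm L V) : V → ChaseTerm L V :=
  fun x => if x ∈ Query.vars R.body then σ x else null R σ x

theorem extend_of_mem {R : Rule L V} {σ : V → ChaseTerm L V} {x : V}
    (h : x ∈ Query.vars R.body) : extend R σ x = σ x := if_pos h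

theorem extend_of_notMem {R : Rule L V} {σ : V → ChaseTerm L V} {x : V}
    (h : x ∉ Query.vars R.body) : extend R σ x = null R σ x := if_neg h

end ChaseTerm

/-- The sets of ground atoms obtained from the fact `F` by finitely many rule applications. -/
inductive IsChaseStage (F : Query L V) (𝓡 : Set (Rule L V)) :
    Set (GroundAtom L (ChaseTerm L V)) → Prop
  | base : IsChaseStage F 𝓡 (Atom.eval .const .var '' F)
  | step {I : Set (GroundAtom L (ChaseTerm L V))} {R : Rule L V} {σ : V → ChaseTerm L V} :
      IsChaseStage F 𝓡 I → R ∈ 𝓡 → Query.HoldsIn .const σ R.body I →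
        IsChaseStage F 𝓡 (I ∪ Atom.eval .const (.extend R σ) '' R.head)

variable {F : Query L V} {𝓡 : Set (Rule L V)} {I J : Set (GroundAtom L (ChaseTerm L V))}

theorem IsChaseStage.base_subset (hI : IsChaseStage F 𝓡 I) :
    Atom.eval .const .var '' (F : Set (Atom L V)) ⊆ I := by
  induction hI with
  | base => exact subset_rfl
  | step _ _ _ ih => exact ih.trans Set.subset_union_left

/-- The applications leading to `J` can be replayed on top of `I`, since bodies stay true in larger
sets. -/
theorem IsChaseStage.union (hI : IsChaseStage F 𝓡 I) (hJ : IsChaseStage F 𝓡 J) :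
    IsChaseStage F 𝓡 (I ∪ J) := by
  induction hJ with
  | base => rwa [Set.union_eq_self_of_subset_right hI.base_subset]
  | step _ hR hσ ih =>
    rw [← Set.union_assoc]
    exact ih.step hR fun a ha => Or.inr (hσ a ha)

theorem Query.HoldsIn.extend {R : Rule L V} {σ : V → ChaseTerm L V}
    (h : Query.HoldsIn .const σ R.body I) : Query.HoldsIn .const (.extend R σ) R.body I :=
  fun a ha => by
    rw [Atom.eval_congr (fun x hx => ChaseTerm.extend_of_mem hx) ha]
    exact h a ha

/-- If a null occurs in a stage of the chase, then the corresponding rule application has been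
performed. -/
theorem IsChaseStage.head_subset (hI : IsChaseStage F 𝓡 I) {R : Rule L V}
    {σ : V → ChaseTerm L V} {z : V} (hz : ChaseTerm.null R σ z ∈ activeDomain I) :
    Atom.eval .const (.extend R σ) '' (R.head : Set (Atom L V)) ⊆ I := by
  induction hI with
  | base =>
    obtain ⟨_, ⟨a, -, rfl⟩, i, hi⟩ := hz
    change (a.args i).eval _ _ = _ at hi
    cases h : a.args i <;> rw [h] at hi <;> cases hi
  | @step I R' τ _ _ hτ ih =>
    obtain ⟨_, ha | ⟨a, ha, rfl⟩, i, hi⟩ := hz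
    · exact (ih ⟨_, ha, i, hi⟩).trans Set.subset_union_left
    · change (a.args i).eval _ _ = _ at hi
      cases h : a.args i with
      | const c =>
        rw [h] at hi
        cases hi
      | var x =>
        rw [h] at hi
        change ChaseTerm.extend R' τ x = _ at hi
        by_cases hx : x ∈ Query.vars R'.body
        -- A null carried by a body variable was already present before this application.
        · refine (ih ?_).trans Set.subset_union_left
          rw [← hi]
          exact hτ.extend.mem_activeDomain hx
        -- A newly created null records its rule and assignment, so this application is the required
        -- one.
        · rw [ChaseTerm.extend_of_notMem hx] at hi
          cases hi
          exact Set.subset_union_right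

/-- As soon as one null of the application is present, so is its whole head. Otherwise all its nulls
are new, and they are distinct because each records its variable. -/
theorem IsChaseStage.isFreshTrigger_or_subset (hI : IsChaseStage F 𝓡 I) {R : Rule L V}
    {σ : V → ChaseTerm L V} (hσ : Query.HoldsIn .const σ R.body I) :
    IsFreshTrigger .const I R (.extend R σ) ∨
      Atom.eval .const (.extend R σ) '' (R.head : Set (Atom L V)) ⊆ I := by
  by_cases h : ∃ y ∈ R.exVars, ChaseTerm.extend R σ y ∈ activeDomain I
  · obtain ⟨y, hy, hmem⟩ := h
    rw [ChaseTerm.extend_of_notMem hy.2] at hmem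
    exact .inr (hI.head_subset hmem)
  · push Not at h
    refine .inl ⟨hσ.extend, h, fun y hy c hc => ?_, fun y hy y' hy' hyy => ?_⟩
    · rw [ChaseTerm.extend_of_notMem hy.2] at hc
      cases hc
    · rw [ChaseTerm.extend_of_notMem hy.2, ChaseTerm.extend_of_notMem hy'.2] at hyy
      cases hyy
      rfl

theorem Query.moreGeneral_of_holdsIn_chase {A B : Query L V} {e : V → ChaseTerm L V}
    (h : Query.HoldsIn .const e A (Atom.eval .const .var '' (B : Set (Atom L V)))) :
    MoreGeneral A B := by
  classical
  -- Only variables that do not occur in `A` can be sent to nulls, so the default value is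
  -- irrelevant.
  let g : ChaseTerm L V → Term L V → Term L V := fun m t => match m with
    | .base t' => t'
    | .null _ _ _ => t
  refine ⟨fun x => g (e x) (.var x), fun c hc => ?_⟩
  obtain ⟨a, ha, rfl⟩ := Query.mem_subst.1 hc
  obtain ⟨b, hb, hba⟩ := h a ha
  have hbase : ∀ t : Term L V, t.eval .const .var = ChaseTerm.base t := fun t => by
    cases t <;> rfl
  suffices a.subst (fun x => g (e x) (.var x)) = b by rwa [this]
  clear ha hb hc
  obtain ⟨n, p, x⟩ := a
  obtain ⟨m, q, y⟩ := b
  simp only [Atom.eval, hbase, GroundAtom.mk.injEq] at hba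
  obtain ⟨rfl, h1, h2⟩ := hba
  simp only [heq_eq_eq] at h1 h2
  subst h1
  simp only [Atom.subst, Atom.mk.injEq, heq_eq_eq, true_and]
  funext i
  have hi := congrFun h2 i
  cases hx : x i with
  | var z =>
    rw [hx] at hi
    change ChaseTerm.base (y i) = e z at hi
    change g (e z) _ = _
    rw [← hi]
  | const c =>
    rw [hx] at hi
    change ChaseTerm.base (y i) = ChaseTerm.base (.const c) at hi
    exact (ChaseTerm.base.inj hi).symm

/-- A query that is true at a stage of the chase has a rewriting that is mapped to the fact. -/
theorem IsChaseStage.exists_rewriting [Infinite V] (hI : IsChaseStage F 𝓡 I) {Q : Query L V}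
    {e : V → ChaseTerm L V} (hQ : Query.HoldsIn .const e Q I) :
    ∃ n, ∃ Q' ∈ (mgPieceRew : RewOp L V).iter Q 𝓡 n, MoreGeneral Q' F := by
  induction hI generalizing Q e with
  | base => exact ⟨0, Q, rfl, Query.moreGeneral_of_holdsIn_chase hQ⟩
  | @step I R σ hI hR hσ ih =>
    -- A redundant application adds nothing; a fresh one is undone by the backward step, and the
    -- induction continues with the rewriting.
    rcases hI.isFreshTrigger_or_subset hσ with hfresh | hsub
    · obtain ⟨R', hc, hd⟩ := R.exists_isCopy_disjoint (Query.finite_vars Q)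
      obtain ⟨τ, hτ, hhead⟩ := hfresh.copy hc
      have hQ' : Query.HoldsIn .const e Q (I ∪ Atom.eval .const τ '' R'.head) := by
        intro a ha
        rcases hQ a ha with h | ⟨b, hb, hba⟩
        · exact .inl h
        · obtain ⟨b', hb', hbb⟩ := hhead b hb
          exact .inr ⟨b', hb', hbb.trans hba⟩
      rcases hτ.exists_mostGeneralPieceUnifier ChaseTerm.const_injective hd hQ' with
        h | ⟨Qs, Hs, P, hP, f, hf⟩
      · exact ih h
      · obtain ⟨s, hs⟩ := exists_isAssociated P hP.prop.admissible
        obtain ⟨n, Q', hQ', hF⟩ := ih (hf s hs)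
        have hmem : pieceRewriting Q R' Qs s ∈ (mgPieceRew : RewOp L V) Q 𝓡 :=
          ⟨R, hR, R', hc, hd, Qs, Hs, P, hP, s, hs, rfl⟩
        exact ⟨n + 1, Q', RewOp.mem_iter_succ_of_mem hmem hQ', hF⟩
    · exact ih fun a ha => (hQ a ha).elim id fun h => hsub h

/-- The set of all atoms of the chase. -/
def chase (F : Query L V) (𝓡 : Set (Rule L V)) : Set (GroundAtom L (ChaseTerm L V)) :=
  {a | ∃ I, IsChaseStage F 𝓡 I ∧ a ∈ I}

/-- Compactness: finitely many atoms lie in finitely many stages, whose union is again a stage. -/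
theorem Query.HoldsIn.exists_isChaseStage {A : Query L V} {e : V → ChaseTerm L V}
    (h : Query.HoldsIn .const e A (chase F 𝓡)) :
    ∃ I, IsChaseStage F 𝓡 I ∧ Query.HoldsIn .const e A I := by
  classical
  induction A using Finset.induction_on with
  | empty => exact ⟨_, .base, fun a ha => by simp at ha⟩
  | insert a A _ ih =>
    obtain ⟨I, hI, hA⟩ := ih fun b hb => h b (Finset.mem_insert_of_mem hb)
    obtain ⟨J, hJ, ha⟩ := h a (Finset.mem_insert_self _ _)
    refine ⟨I ∪ J, hI.union hJ, fun b hb => ?_⟩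
    rcases Finset.mem_insert.1 hb with rfl | hb
    · exact .inr ha
    · exact .inl (hA b hb)

/-- The structure whose true atoms are those of the chase. -/
@[reducible]
noncomputable def chaseStructure [Nonempty V] (F : Query L V) (𝓡 : Set (Rule L V)) :
    L.Structure (ChaseTerm L V) where
  funMap {n} := match n with
    | 0 => fun c _ => .const c
    -- Terms involve no function symbol of positive arity, so any value will do.
    | _ + 1 => fun _ _ => .var (Classical.arbitrary V)
  RelMap {n} p x := ⟨n, p, x⟩ ∈ chase F 𝓡

theorem holds_chaseStructure [Nonempty V] (A : Query L V) (e : V → ChaseTerm L V) :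
    let := chaseStructure F 𝓡
    Query.Holds e A ↔ Query.HoldsIn .const e A (chase F 𝓡) := by
  let _ := chaseStructure F 𝓡
  have : ∀ t : Term L V, t.val e = t.eval .const e := fun t => by cases t <;> rfl
  refine forall₂_congr fun a _ => ?_
  simp only [this]
  rfl

/-- Every query that is entailed has a rewriting that is mapped to the fact. -/
theorem Entails.exists_rewriting [Infinite V] {Q : Query L V} (h : Entails F 𝓡 Q) :
    ∃ n, ∃ Q' ∈ (mgPieceRew : RewOp L V).iter Q 𝓡 n, MoreGeneral Q' F := by
  let _ := chaseStructure F 𝓡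
  have : Nonempty (ChaseTerm L V) := ⟨.var (Classical.arbitrary V)⟩
  -- The chase is a model of the fact and the rules: a body true in it is true at some finite stage,
  -- where the rule can be applied.
  obtain ⟨e, he⟩ := h (ChaseTerm L V)
    ⟨.var, (holds_chaseStructure F _).2 fun a ha => ⟨_, .base, a, ha, rfl⟩⟩ fun R hR σ hσ => by
      obtain ⟨I, hI, hσI⟩ := ((holds_chaseStructure R.body σ).1 hσ).exists_isChaseStage
      exact ⟨.extend R σ, fun x hx => ChaseTerm.extend_of_mem hx,
        (holds_chaseStructure R.head _).2 fun a ha => ⟨_, hI.step hR hσI, .inr ⟨a, ha, rfl⟩⟩⟩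
  obtain ⟨I, hI, hQ⟩ := ((holds_chaseStructure Q e).1 he).exists_isChaseStage
  exact hI.exists_rewriting hQ

end Chase

/-! ### Properties of the two rewriting operators -/

section Operators

variable {L : FirstOrder.Language.{u, v}} {V : Type w}

theorem MoreGeneral.entails {Q F : Query L V} (h : MoreGeneral Q F) : Entails F ∅ Q :=
  fun _ _ _ hF _ => hF.of_moreGeneral h

theorem pieceRew_sound : (pieceRew : RewOp L V).Sound :=
  fun _ _ _ hQ' _ h M _ _ hF h𝓡 => sat_of_mem_pieceRew hQ' h𝓡 (h M hF (by simp))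

theorem mgPieceRew_sound : (mgPieceRew : RewOp L V).Sound :=
  fun 𝓡 Q Q' hQ' => pieceRew_sound 𝓡 Q Q' (mgPieceRew_subset Q 𝓡 hQ')

theorem RewOp.mem_satInf_of_mem_iter {rew : RewOp L V} {Q Q' : Query L V} {𝓡 : Set (Rule L V)}
    {n : ℕ} (h : Q' ∈ rew.iter Q 𝓡 n) : Q' ∈ rew.satInf Q 𝓡 :=
  Set.mem_iUnion.2 ⟨n, n, le_rfl, h⟩

theorem mgPieceRew_complete [Infinite V] : (mgPieceRew : RewOp L V).Complete := by
  intro 𝓡 Q F h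
  obtain ⟨n, Q', hQ', hF⟩ := h.exists_rewriting
  exact ⟨Q', RewOp.mem_satInf_of_mem_iter hQ', hF.entails⟩

theorem pieceRew_complete [Infinite V] : (pieceRew : RewOp L V).Complete := by
  intro 𝓡 Q F h
  obtain ⟨n, Q', hQ', hF⟩ := h.exists_rewriting
  exact ⟨Q', RewOp.mem_satInf_of_mem_iter (RewOp.iter_mono mgPieceRew_subset Q 𝓡 n hQ'),
    hF.entails⟩

/-- One-step rewritings of a query are covered by any more general query or by its one-step
rewritings according to most general piece-unifiers. -/
theorem exists_mem_mgPieceRew_moreGeneral [Infinite V] {𝓡 : Set (Rule L V)} {Q₁ Q₂ Q₂' : Query L V}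
    (hQ : MoreGeneral Q₁ Q₂) (hQ₂' : Q₂' ∈ (pieceRew : RewOp L V) Q₂ 𝓡)
    (hn : ¬ MoreGeneral Q₁ Q₂') :
    ∃ Q₁' ∈ (mgPieceRew : RewOp L V) Q₁ 𝓡, MoreGeneral Q₁' Q₂' := by
  obtain ⟨R, hR, R', hc, hd, Qs, Hs, P, hP, s, hs, rfl⟩ := hQ₂'
  obtain ⟨R'', hc', hd'⟩ := R'.exists_isCopy_disjoint (Query.finite_vars Q₁)
  obtain ⟨Qs₁, Hs₁, P₁, hP₁, h⟩ := (hP.lift hc' hd' hd hQ hs).resolve_left hn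
  obtain ⟨s₁, hs₁⟩ := exists_isAssociated P₁ hP₁.prop.admissible
  exact ⟨_, ⟨R, hR, R'', hc.trans hc', hd', Qs₁, Hs₁, P₁, hP₁, s₁, hs₁, rfl⟩, h s₁ hs₁⟩

theorem mgPieceRew_prunable [Infinite V] : (mgPieceRew : RewOp L V).Prunable :=
  fun 𝓡 _ Q₂ _ hQ hQ₂' hn =>
    exists_mem_mgPieceRew_moreGeneral hQ (mgPieceRew_subset Q₂ 𝓡 hQ₂') hn

theorem pieceRew_prunable [Infinite V] : (pieceRew : RewOp L V).Prunable := by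
  intro 𝓡 Q₁ Q₂ Q₂' hQ hQ₂' hn
  obtain ⟨Q₁', h, h'⟩ := exists_mem_mgPieceRew_moreGeneral hQ hQ₂' hn
  exact ⟨Q₁', mgPieceRew_subset Q₁ 𝓡 h, h'⟩

end Operators

end ExistentialRules

theorem theorem5 {L : FirstOrder.Language.{u, v}} {V : Type w} [Infinite V] :
    -- the piece-based rewriting operator is sound, complete and prunable
    ((pieceRew : RewOp L V).Sound ∧ (pieceRew : RewOp L V).Complete ∧
      (pieceRew : RewOp L V).Prunable) ∧
    -- and so is its restriction to most general piece-unifiers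
    ((mgPieceRew : RewOp L V).Sound ∧ (mgPieceRew : RewOp L V).Complete ∧
      (mgPieceRew : RewOp L V).Prunable) ∧
    -- one-step piece-rewritings of a less general query are covered
    (∀ (Q₁ Q₂ : Query L V) (R : Rule L V),
      Disjoint (Query.vars Q₁) R.vars → Disjoint (Query.vars Q₂) R.vars → MoreGeneral Q₁ Q₂ →
      ∀ (Qs₂ Hs₂ : Query L V) (P₂ : TermPartition (Query.terms Qs₂ ∪ Query.terms Hs₂)),
        IsPieceUnifier Q₂ R Qs₂ Hs₂ P₂ → ∀ s₂ : Subst L V, IsAssociated P₂ s₂ →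
        MoreGeneral Q₁ (pieceRewriting Q₂ R Qs₂ s₂) ∨
        ∃ (Qs₁ Hs₁ : Query L V) (P₁ : TermPartition (Query.terms Qs₁ ∪ Query.terms Hs₁)),
          IsPieceUnifier Q₁ R Qs₁ Hs₁ P₁ ∧ ∀ s₁ : Subst L V, IsAssociated P₁ s₁ →
            MoreGeneral (pieceRewriting Q₁ R Qs₁ s₁) (pieceRewriting Q₂ R Qs₂ s₂)) ∧
    -- logical entailment amounts to the existence of a piece-rewriting mapped to the fact
    (∀ (F : Query L V) (𝓡 : Set (Rule L V)) (Q : Query L V),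
      Entails F 𝓡 Q ↔
        ∃ k : ℕ, ∃ Q' ∈ (pieceRew : RewOp L V).iter Q 𝓡 k, MoreGeneral Q' F) := by
  refine ⟨⟨pieceRew_sound, pieceRew_complete, pieceRew_prunable⟩,
    ⟨mgPieceRew_sound, mgPieceRew_complete, mgPieceRew_prunable⟩, ?_, ?_⟩
  · intro Q₁ Q₂ R hd₁ hd₂ hQ Qs₂ Hs₂ P₂ hμ s₂ hs₂
    refine (hμ.lift (.refl R) hd₁ hd₂ hQ hs₂).imp_right ?_
    rintro ⟨Qs₁, Hs₁, P₁, hP₁, h⟩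
    exact ⟨Qs₁, Hs₁, P₁, hP₁.prop, h⟩
  · intro F 𝓡 Q
    constructor
    · intro h
      obtain ⟨n, Q', hQ', hF⟩ := h.exists_rewriting
      exact ⟨n, Q', RewOp.iter_mono mgPieceRew_subset Q 𝓡 n hQ', hF⟩
    · rintro ⟨n, Q', hQ', hF⟩ M _ _ hMF h𝓡
      exact sat_of_mem_iter_pieceRew h𝓡 hQ' (hMF.of_moreGeneral hF)
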